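/- Let $\hat c > 8$ and let $n\ge 1$ be an integer. Put $c=\sqrt n\,\hat c$ and let $H_{n,n,n}$ be the multiple Hermite polynomial with parameters $(-c,0,c)$, i.e. the monic polynomial of degree $3n$ such that $$\int_{-\infty}^{\infty} x^k H_{n,n,n}(x)\, e^{-x^2+c_jx}\,dx=0,\qquad 0\le k\le n-1,\quad c_j\in\{-c,0,c\}.$$ This polynomial exists and is unique, and its zeros are real and simple. Let $x_{1,3n}<\dots<x_{3n,3n}$ be the zeros of the rescaled polynomial $x\mapsto H_{n,n,n}(\sqrt n\,x)$. There are unique real numbers $\lambda^{(1)}_{k,3n}$ $(1\le k\le 3n)$ such that $$\int_{-\infty}^{\infty} f(x)\,e^{-n(x^2+\hat c x)}\,dx=\sum_{k=1}^{3n}\lambda^{(1)}_{k,3n}f(x_{k,3n})$$ for all real polynomials $f$ of degree at most $4n-1$, and they satisfy $$\lambda^{(1)}_{k,3n}>0\quad(1\le k\le n),\qquad \operatorname{sign}\lambda^{(1)}_{k,3n}=(-1)^{k-n+1}\quad(n+1\le k\le 3n).$$ -/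

import Mathlib

open Polynomial MeasureTheory

/-- `P` is a type II multiple orthogonal polynomial for the weight functions `w 0, …, w (r-1)` on `ℝ`
and the multi-index `m`: it is monic of degree `m 0 + ⋯ + m (r-1)` and
`∫ x ^ k * P x * w j x dx = 0` for all `k ≤ m j - 1` and all `j`. -/
def IsTypeIIMultipleOrthogonal {r : ℕ} (w : Fin r → ℝ → ℝ) (m : Fin r → ℕ) (P : ℝ[X]) : Prop :=
  P.Monic ∧ P.natDegree = ∑ j, m j ∧
    ∀ j, ∀ k < m j, ∫ x : ℝ, x ^ k * P.eval x * w j x = 0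

/-- The weights `exp (-x² + c_j x)` of the multiple Hermite polynomials. -/
noncomputable def hermiteWeight {r : ℕ} (c : Fin r → ℝ) (j : Fin r) (x : ℝ) : ℝ :=
  Real.exp (-x ^ 2 + c j * x)

/-- `H` is the multiple Hermite polynomial with parameters `c` and multi-index `m`. -/
def IsMultipleHermite {r : ℕ} (c : Fin r → ℝ) (m : Fin r → ℕ) (H : ℝ[X]) : Prop :=
  IsTypeIIMultipleOrthogonal (hermiteWeight c) m H

/-- `H` is `H_{n,n,n}` for the parameters `(-c, 0, c)` with `c = √n * chat`. -/
def IsHermiteDiag (chat : ℝ) (n : ℕ) (H : ℝ[X]) : Prop :=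
  IsMultipleHermite ![-(√(n : ℝ) * chat), 0, √(n : ℝ) * chat] ![n, n, n] H

/-- `x 0 < x 1 < ⋯ < x (3n-1)` is the list of all real zeros of `y ↦ H (√n * y)`. For `H` of
degree `3n` this says that all zeros of `H` are real and simple. -/
def IsNodes (n : ℕ) (H : ℝ[X]) (x : Fin (3 * n) → ℝ) : Prop :=
  StrictMono x ∧ Set.range x = {y : ℝ | H.eval (√(n : ℝ) * y) = 0}

/-- `lam` are the weights at the nodes `x` of the quadrature rule for the weight function
`exp (-n (x² + chat x))` that is exact for polynomials of degree at most `4n - 1`. -/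
def IsFirstQuadratureWeights (chat : ℝ) (n : ℕ) (x lam : Fin (3 * n) → ℝ) : Prop :=
  ∀ f : ℝ[X], f.natDegree ≤ 4 * n - 1 →
    ∫ y : ℝ, f.eval y * Real.exp (-(n : ℝ) * (y ^ 2 + chat * y)) = ∑ k, lam k * f.eval (x k)

/-!
With `a = √n * chat / 2 > 4 √n`, the weights are multiples of `exp (-(x - b)²)` with centre `b` equal
to `-a`, `0` or `a`, and the polynomial is `H = exp (-D² / 4) ((X + a)^n X^n (X - a)^n)`. Indeed
`exp (-D² / 4)` is inverse to averaging over a Gaussian, so that orthogonality of `exp (-D² / 4) p`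
to the polynomials of degree less than `n` with respect to the weight centred at `b` means that
`(X - b)^n` divides `p`. This gives existence and uniqueness (`isMultipleHermite_iff`).

More generally let `H_s` be the image under `exp (-D² / 4)` of `∏ b ∈ s, (X - b)`
(`hermiteOfCentres`). Two facts about its zeros are used.

* Adding a centre adds a zero, and old and new zeros interlace (`hermiteOfCentres_cons_interlace`),
  because `H_{b, s}` is a multiple of `exp ((x - b)²) * (exp (-(x - b)²) H_s)'`.
* No zero lies farther than `√(2 |s|)` outside the range of the centres (`hermiteOfCentres_sign`),
  because of the recurrence `H_{b, s} = (x - b) H_s - (1 / 2) ∑ c ∈ s, H_{s \ c}`.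

Hence the zeros for `n` centres `0` and `n` centres `a` are all greater than `-2 √n`. Adding `n`
centres `-a` leaves all zeros of `H` but the first `n` in `(-2 √n, ∞)`. On the other hand the
Gauss-Hermite rule with `2 n` nodes centred at `-a` is exact up to degree `4 n - 1`, has positive
weights, and its nodes are less than `-a + 2 √n < -2 √n`. Thus a polynomial of degree at most
`4 n - 1` integrates against the first weight as if only the half-line to the left of all those
`2 n` zeros mattered (`gaussianFunctional_pos_of_nonneg_of_lt`).

Write `H = p q`, where `p` carries the first `n` zeros. Both test polynomials below have degree at
most `4 n - 1`, constant sign on that half-line, and vanish at all nodes but the `k`-th one, so that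
their integral is the `k`-th weight times their value there: `(p / (X - y_k))² q` if `y_k` is a zero
of `p` (`weight_pos_of_lt`), and `p² (q / (X - y_k))` if it is a zero of `q` (`weight_sign_of_le`).
-/

/-! ### The Hermite transform of a polynomial -/

/-- The operator `p ↦ X * p - p' / 2`. Up to the factor `-1/2` it is the derivative conjugated by
the weight `exp (-x²)`. -/
noncomputable def hermiteRaising : Module.End ℝ ℝ[X] :=
  LinearMap.mulLeft ℝ X - (2⁻¹ : ℝ) • Polynomial.derivative

/-- The inverse heat flow `exp (-D² / 4)` on polynomials, which sends `X ^ n` to the monic Hermite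
polynomial of degree `n`. It is encoded as `p ↦ p(A) 1` with `A = X - D / 2`. -/
noncomputable def hermiteTransform : ℝ[X] →ₗ[ℝ] ℝ[X] :=
  (LinearMap.applyₗ (1 : ℝ[X])) ∘ₗ (aeval hermiteRaising).toLinearMap

lemma hermiteTransform_C (a : ℝ) : hermiteTransform (C a) = C a := by
  simp [hermiteTransform, Algebra.algebraMap_eq_smul_one, smul_eq_C_mul]

lemma hermiteTransform_one : hermiteTransform 1 = 1 := by
  simp [hermiteTransform]

lemma hermiteTransform_X_mul (p : ℝ[X]) :
    hermiteTransform (X * p) =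
      X * hermiteTransform p - C (2⁻¹ : ℝ) * derivative (hermiteTransform p) := by
  simp [hermiteTransform, hermiteRaising, smul_eq_C_mul]

lemma hermiteTransform_C_mul (a : ℝ) (p : ℝ[X]) :
    hermiteTransform (C a * p) = C a * hermiteTransform p := by
  rw [← smul_eq_C_mul, map_smul, smul_eq_C_mul]

lemma hermiteTransform_X_sub_C_mul (b : ℝ) (p : ℝ[X]) :
    hermiteTransform ((X - C b) * p) =
      (X - C b) * hermiteTransform p - C (2⁻¹ : ℝ) * derivative (hermiteTransform p) := by
  rw [sub_mul, map_sub, hermiteTransform_X_mul, hermiteTransform_C_mul]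
  ring

lemma derivative_hermiteTransform (p : ℝ[X]) :
    derivative (hermiteTransform p) = hermiteTransform (derivative p) := by
  induction p using Polynomial.induction_on' with
  | add p q hp hq => simp [hp, hq]
  | monomial n a =>
    rw [← C_mul_X_pow_eq_monomial, derivative_C_mul, hermiteTransform_C_mul,
      hermiteTransform_C_mul, derivative_C_mul]
    congr 1
    induction n with
    | zero => simp [hermiteTransform_one]
    | succ n ih =>
      rw [pow_succ', hermiteTransform_X_mul, derivative_mul, map_add, hermiteTransform_X_mul, ← ih]
      simp only [derivative_X, one_mul, derivative_sub, derivative_mul, derivative_C, zero_mul,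
        zero_add, add_sub_assoc]

lemma hermiteTransform_natDegree_le_and_coeff (k : ℕ) (p : ℝ[X]) (hp : p.natDegree ≤ k) :
    (hermiteTransform p).natDegree ≤ k ∧ (hermiteTransform p).coeff k = p.coeff k := by
  induction k generalizing p with
  | zero =>
    rw [eq_C_of_natDegree_le_zero hp, hermiteTransform_C]
    simp
  | succ k ih =>
    obtain ⟨h1, h2⟩ := ih p.divX (by rw [natDegree_divX_eq_natDegree_tsub_one]; omega)
    have hU : hermiteTransform p = X * hermiteTransform p.divX
        - C (2⁻¹ : ℝ) * derivative (hermiteTransform p.divX) + C (p.coeff 0) := by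
      conv_lhs => rw [← X_mul_divX_add p]
      rw [map_add, hermiteTransform_X_mul, hermiteTransform_C]
    constructor
    · rw [natDegree_le_iff_coeff_eq_zero] at h1 ⊢
      intro N hN
      obtain ⟨N, rfl⟩ : ∃ M, N = M + 1 := ⟨N - 1, by omega⟩
      rw [hU]
      simp [coeff_derivative, h1 N (by omega), h1 (N + 1 + 1) (by omega)]
    · rw [natDegree_le_iff_coeff_eq_zero] at h1
      rw [hU]
      simp [coeff_derivative, h2, h1 (k + 1 + 1) (by omega), coeff_divX]

lemma hermiteTransform_monic {p : ℝ[X]} (hp : p.Monic) :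
    (hermiteTransform p).Monic ∧ (hermiteTransform p).natDegree = p.natDegree := by
  obtain ⟨h1, h2⟩ := hermiteTransform_natDegree_le_and_coeff _ p le_rfl
  have h3 : (hermiteTransform p).coeff p.natDegree = 1 := by rw [h2]; exact hp
  exact ⟨monic_of_natDegree_le_of_coeff_eq_one _ h1 h3,
    natDegree_eq_of_le_of_coeff_ne_zero h1 (by simp [h3])⟩

lemma exists_hermiteTransform_eq (k : ℕ) (q : ℝ[X]) (hq : q.degree < k) :
    ∃ p : ℝ[X], p.degree < k ∧ hermiteTransform p = q := by
  induction k generalizing q with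
  | zero =>
    refine ⟨0, by simp, ?_⟩
    have : q = 0 := by
      rw [← degree_eq_bot]
      exact Nat.WithBot.lt_zero_iff.mp (by simpa using hq)
    simp [this]
  | succ k ih =>
    set m : ℝ[X] := monomial k (q.coeff k) with hm
    obtain ⟨h1, h2⟩ := hermiteTransform_natDegree_le_and_coeff k m (natDegree_monomial_le _)
    obtain ⟨p, hp, hpq⟩ := ih (q - hermiteTransform m) (by
      rw [degree_lt_iff_coeff_zero] at hq ⊢
      intro j hj
      rcases hj.eq_or_lt with rfl | hj
      · rw [coeff_sub, h2, hm, coeff_monomial_same, sub_self]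
      · rw [coeff_sub, hq j hj, natDegree_le_iff_coeff_eq_zero.mp h1 j hj, sub_zero])
    refine ⟨p + m, ?_, by rw [map_add, hpq]; ring⟩
    rw [degree_lt_iff_coeff_zero] at hp ⊢
    intro j hj
    rw [coeff_add, hp j (by omega), hm, coeff_monomial, if_neg (by omega), add_zero]

lemma exists_monic_hermiteTransform_eq {q : ℝ[X]} (hq : q.Monic) :
    ∃ p : ℝ[X], p.Monic ∧ p.natDegree = q.natDegree ∧ hermiteTransform p = q := by
  obtain ⟨p, hp, rfl⟩ := exists_hermiteTransform_eq (q.natDegree + 1) q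
    (by rw [degree_eq_natDegree hq.ne_zero]; exact_mod_cast Nat.lt_succ_self _)
  have hle : p.natDegree ≤ (hermiteTransform p).natDegree := by
    rw [natDegree_le_iff_coeff_eq_zero]
    intro j hj
    exact (degree_lt_iff_coeff_zero _ _).mp hp j hj
  obtain ⟨-, h2⟩ := hermiteTransform_natDegree_le_and_coeff _ p hle
  have h3 : p.coeff (hermiteTransform p).natDegree = 1 := by rw [← h2]; exact hq
  exact ⟨p, monic_of_natDegree_le_of_coeff_eq_one _ hle h3,
    natDegree_eq_of_le_of_coeff_ne_zero hle (by simp [h3]), rfl⟩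

/-! ### Integration of polynomials against a shifted Gaussian -/

lemma integrable_eval_mul_exp (c : ℝ) (f : ℝ[X]) :
    Integrable fun x : ℝ => f.eval x * Real.exp (-x ^ 2 + c * x) := by
  -- completing the square reduces to a centred Gaussian
  have key : ∀ g : ℝ[X], Integrable fun x : ℝ => g.eval x * Real.exp (-x ^ 2) := by
    intro g
    induction g using Polynomial.induction_on' with
    | add p q hp hq => simpa only [eval_add, add_mul] using! hp.add hq
    | monomial k a =>
      have := (integrable_rpow_mul_exp_neg_mul_sq (b := 1) one_pos (s := k)
        (by have := Nat.cast_nonneg (α := ℝ) k; linarith)).const_mul a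
      simpa [mul_assoc] using this
  have h := ((key (f.comp (X + C (c / 2)))).comp_sub_right (c / 2)).mul_const
    (Real.exp (c ^ 2 / 4))
  refine h.congr (.of_forall fun x => ?_)
  simp only [eval_comp, eval_add, eval_X, eval_C, sub_add_cancel, mul_assoc, ← Real.exp_add]
  congr 2
  ring

/-- Integration of polynomials against the weight `exp (-x² + c x)`. -/
noncomputable def gaussianFunctional (c : ℝ) : ℝ[X] →ₗ[ℝ] ℝ where
  toFun f := ∫ x : ℝ, f.eval x * Real.exp (-x ^ 2 + c * x)
  map_add' f g := by
    simp only [eval_add, add_mul]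
    exact integral_add (integrable_eval_mul_exp c f) (integrable_eval_mul_exp c g)
  map_smul' a f := by
    simp only [eval_smul, smul_eq_mul, mul_assoc, RingHom.id_apply]
    exact integral_const_mul a _

lemma gaussianFunctional_apply (c : ℝ) (f : ℝ[X]) :
    gaussianFunctional c f = ∫ x : ℝ, f.eval x * Real.exp (-x ^ 2 + c * x) := rfl

lemma gaussianFunctional_sq_pos (c : ℝ) {f : ℝ[X]} (hf : f ≠ 0) :
    0 < gaussianFunctional c (f ^ 2) := by
  obtain ⟨x, hx⟩ : ∃ x, f.eval x ≠ 0 := by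
    by_contra! h
    exact hf (Polynomial.funext (by simpa using h))
  rw [gaussianFunctional_apply]
  refine integral_pos_of_integrable_nonneg_nonzero (x := x) (by fun_prop)
    (integrable_eval_mul_exp c _) (fun y => ?_) ?_
  · simp only [Pi.zero_apply, eval_pow]
    positivity
  · simp [hx, Real.exp_ne_zero]

lemma gaussianFunctional_one_pos (c : ℝ) : 0 < gaussianFunctional c 1 := by
  simpa using gaussianFunctional_sq_pos c (one_ne_zero (α := ℝ[X]))

/-- The integrand is `-1/2` times the derivative of `f x * exp (-x² + c x)`. -/
lemma gaussianFunctional_raising (c : ℝ) (f : ℝ[X]) :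
    gaussianFunctional c ((X - C (c / 2)) * f - C (2⁻¹ : ℝ) * derivative f) = 0 := by
  rw [gaussianFunctional_apply]
  refine integral_eq_zero_of_hasDerivAt_of_integrable
    (f := fun x => (C (-2⁻¹ : ℝ) * f).eval x * Real.exp (-x ^ 2 + c * x)) (fun x => ?_)
    (integrable_eval_mul_exp c _) (integrable_eval_mul_exp c _)
  have h1 := (C (-2⁻¹ : ℝ) * f).hasDerivAt x
  have h2 : HasDerivAt (fun x : ℝ => Real.exp (-x ^ 2 + c * x))
      (Real.exp (-x ^ 2 + c * x) * (-(2 * x) + c)) x := by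
    have := ((hasDerivAt_pow 2 x).neg.add ((hasDerivAt_id x).const_mul c)).exp
    simpa using this
  refine (h1.mul h2).congr_deriv ?_
  simp only [eval_sub, eval_mul, eval_X, eval_C, derivative_mul, derivative_C, zero_mul, zero_add]
  ring

lemma gaussianFunctional_mul_raising (c : ℝ) (g f : ℝ[X]) :
    gaussianFunctional c (g * ((X - C (c / 2)) * f - C (2⁻¹ : ℝ) * derivative f)) =
      2⁻¹ * gaussianFunctional c (derivative g * f) := by
  have h := gaussianFunctional_raising c (g * f)
  have e : g * ((X - C (c / 2)) * f - C (2⁻¹ : ℝ) * derivative f) =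
      ((X - C (c / 2)) * (g * f) - C (2⁻¹ : ℝ) * derivative (g * f)) +
        (2⁻¹ : ℝ) • (derivative g * f) := by
    rw [derivative_mul, smul_eq_C_mul]
    ring
  rw [e, map_add, h, zero_add, map_smul, smul_eq_mul]

lemma gaussianFunctional_mul_hermiteTransform (c : ℝ) (m : ℕ) (g q : ℝ[X]) :
    gaussianFunctional c (g * hermiteTransform ((X - C (c / 2)) ^ m * q)) =
      2⁻¹ ^ m * gaussianFunctional c (derivative^[m] g * hermiteTransform q) := by
  induction m generalizing g with
  | zero => simp
  | succ m ih =>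
    rw [pow_succ', mul_assoc, hermiteTransform_X_sub_C_mul, gaussianFunctional_mul_raising, ih,
      Function.iterate_succ_apply, pow_succ']
    ring

/-- The Gaussian average undoes the inverse heat flow. -/
lemma gaussianFunctional_hermiteTransform (c : ℝ) (p : ℝ[X]) :
    gaussianFunctional c (hermiteTransform p) = p.eval (c / 2) * gaussianFunctional c 1 := by
  have h : p = (X - C (c / 2)) * (p /ₘ (X - C (c / 2))) + C (p.eval (c / 2)) := by
    rw [← modByMonic_X_sub_C_eq_C_eval, add_comm, modByMonic_add_div]
  conv_lhs => rw [h]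
  rw [map_add, hermiteTransform_X_sub_C_mul, map_add, gaussianFunctional_raising,
    hermiteTransform_C, zero_add, ← mul_one (C _), ← smul_eq_C_mul, map_smul, smul_eq_mul]

/-! ### Existence and uniqueness of the multiple Hermite polynomials -/

lemma integral_pow_mul_eval_mul_hermiteWeight {r : ℕ} (c : Fin r → ℝ) (j : Fin r) (k : ℕ)
    (P : ℝ[X]) :
    ∫ x : ℝ, x ^ k * P.eval x * hermiteWeight c j x = gaussianFunctional (c j) (X ^ k * P) := by
  simp [gaussianFunctional_apply, hermiteWeight]

/-- Orthogonality on polynomials of degree less than `m` to the weight centred at `c / 2` says that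
the inverse image under the inverse heat flow vanishes to order `m` at `c / 2`. -/
lemma X_sub_C_pow_dvd_of_orthogonal (c : ℝ) (m : ℕ) (p : ℝ[X])
    (h : ∀ g : ℝ[X], g.natDegree < m → gaussianFunctional c (g * hermiteTransform p) = 0) :
    (X - C (c / 2)) ^ m ∣ p := by
  induction m with
  | zero => simp
  | succ m ih =>
    obtain ⟨q, rfl⟩ := ih fun g hg => h g (by omega)
    have h0 := h (X ^ m) (by simp)
    rw [gaussianFunctional_mul_hermiteTransform, iterate_derivative_X_pow_eq_smul,
      Nat.sub_self, pow_zero, Nat.descFactorial_self, smul_mul_assoc, one_mul, map_smul, smul_eq_mul,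
      gaussianFunctional_hermiteTransform] at h0
    have hq : q.IsRoot (c / 2) := by
      simpa [Nat.factorial_ne_zero, (gaussianFunctional_one_pos c).ne'] using h0
    rw [pow_succ]
    exact mul_dvd_mul_left _ (dvd_iff_isRoot.mpr hq)

theorem isMultipleHermite_iff {r : ℕ} (c : Fin r → ℝ) (hc : Function.Injective c)
    (m : Fin r → ℕ) (H : ℝ[X]) :
    IsMultipleHermite c m H ↔ H = hermiteTransform (∏ j, (X - C (c j / 2)) ^ m j) := by
  have hmon : (∏ j, (X - C (c j / 2)) ^ m j).Monic :=
    monic_prod_of_monic _ _ fun j _ => (monic_X_sub_C _).pow _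
  have hdeg : (∏ j, (X - C (c j / 2)) ^ m j).natDegree = ∑ j, m j := by
    rw [natDegree_prod_of_monic _ _ fun j _ => (monic_X_sub_C _).pow _]
    simp
  simp only [IsMultipleHermite, IsTypeIIMultipleOrthogonal,
    integral_pow_mul_eval_mul_hermiteWeight]
  constructor
  · rintro ⟨hH, hN, ho⟩
    obtain ⟨p, hp, hpN, rfl⟩ := exists_monic_hermiteTransform_eq hH
    congr 1
    refine eq_of_monic_of_dvd_of_natDegree_le hmon hp ?_ (by omega)
    refine Finset.prod_dvd_of_coprime (fun i _ j _ hij => ?_) fun j _ => ?_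
    · refine IsCoprime.pow (isCoprime_X_sub_C_of_isUnit_sub ?_)
      rw [isUnit_iff_ne_zero, sub_ne_zero]
      intro h
      exact hij (hc (by linarith))
    · refine X_sub_C_pow_dvd_of_orthogonal _ _ _ fun g hg => ?_
      rw [g.as_sum_range' (m j) hg, Finset.sum_mul, map_sum]
      refine Finset.sum_eq_zero fun k hk => ?_
      rw [← smul_X_eq_monomial, smul_mul_assoc, map_smul, ho j k (Finset.mem_range.mp hk),
        smul_zero]
  · rintro rfl
    obtain ⟨h1, h2⟩ := hermiteTransform_monic hmon
    refine ⟨h1, h2.trans hdeg, fun j k hk => ?_⟩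
    rw [← Finset.mul_prod_erase _ _ (Finset.mem_univ j), gaussianFunctional_mul_hermiteTransform,
      iterate_derivative_eq_zero (by simpa using hk)]
    simp

/-! ### Multiple Hermite polynomials with arbitrary centres -/

/-- The multiple Hermite polynomial with the multiset `s` of centres: a weight
`exp (-(x - b)²)` occurs in it as many times as `b` occurs in `s`. -/
noncomputable def hermiteOfCentres (s : Multiset ℝ) : ℝ[X] :=
  hermiteTransform (s.map fun b => X - C b).prod

lemma hermiteOfCentres_zero : hermiteOfCentres 0 = 1 := by
  simp [hermiteOfCentres, hermiteTransform_one]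

lemma hermiteOfCentres_cons (b : ℝ) (s : Multiset ℝ) :
    hermiteOfCentres (b ::ₘ s) =
      (X - C b) * hermiteOfCentres s - C (2⁻¹ : ℝ) * derivative (hermiteOfCentres s) := by
  rw [hermiteOfCentres, Multiset.map_cons, Multiset.prod_cons, hermiteTransform_X_sub_C_mul,
    hermiteOfCentres]

lemma derivative_hermiteOfCentres (s : Multiset ℝ) :
    derivative (hermiteOfCentres s) = (s.map fun b => hermiteOfCentres (s.erase b)).sum := by
  rw [hermiteOfCentres, derivative_hermiteTransform, derivative_prod, map_multiset_sum,
    Multiset.map_map]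
  simp [hermiteOfCentres]

lemma hermiteOfCentres_monic (s : Multiset ℝ) :
    (hermiteOfCentres s).Monic ∧ (hermiteOfCentres s).natDegree = s.card := by
  obtain ⟨h1, h2⟩ := hermiteTransform_monic
    (monic_multiset_prod_of_monic s (fun b => X - C b) fun b _ => monic_X_sub_C b)
  refine ⟨h1, h2.trans ?_⟩
  rw [natDegree_multiset_prod_of_monic _ (by simp [monic_X_sub_C])]
  simp

/-- A zero-free region: no zero is farther than `√(2 |s|)` to the right (`σ = 1`) or to the left
(`σ = -1`) of all centres. The second half of the conclusion carries the induction through the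
recurrence `H_{b, s} = (x - b) H_s - (1 / 2) ∑ c ∈ s, H_{s \ c}`. -/
lemma hermiteOfCentres_pos_and_growth {σ R x : ℝ} (hσ : σ * σ = 1) (hR : 0 < R)
    (s : Multiset ℝ) (hs : 2 * (s.card : ℝ) ≤ R ^ 2) (hx : ∀ b ∈ s, R ≤ σ * (x - b)) :
    0 < σ ^ s.card * (hermiteOfCentres s).eval x ∧
      ∀ b, R ≤ σ * (x - b) → R / 2 * (σ ^ s.card * (hermiteOfCentres s).eval x) ≤
        σ ^ (s.card + 1) * (hermiteOfCentres (b ::ₘ s)).eval x := by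
  induction hk : s.card using Nat.strong_induction_on generalizing s with
  | _ k ih =>
    subst hk
    have herase : ∀ c ∈ s, (s.erase c).card + 1 = s.card := fun c hc =>
      Multiset.card_erase_add_one hc
    have step : ∀ c ∈ s,
        0 < σ ^ (s.erase c).card * (hermiteOfCentres (s.erase c)).eval x ∧
        R / 2 * (σ ^ (s.erase c).card * (hermiteOfCentres (s.erase c)).eval x) ≤
          σ ^ s.card * (hermiteOfCentres s).eval x := by
      intro c hc
      have he := herase c hc
      have he' : ((s.erase c).card : ℝ) + 1 = s.card := by exact_mod_cast he
      obtain ⟨h1, h2⟩ := ih _ (by omega) (s.erase c) (by linarith)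
        (fun b hb => hx b (Multiset.mem_of_mem_erase hb)) rfl
      have h3 := h2 c (hx c hc)
      rw [Multiset.cons_erase hc, he] at h3
      exact ⟨h1, h3⟩
    have hpos : 0 < σ ^ s.card * (hermiteOfCentres s).eval x := by
      rcases s.empty_or_exists_mem with rfl | ⟨c, hc⟩
      · simp [hermiteOfCentres_zero]
      · obtain ⟨h1, h2⟩ := step c hc
        exact (by positivity : 0 < R / 2 * _).trans_le h2
    refine ⟨hpos, fun b hb => ?_⟩
    set q := σ ^ s.card * (hermiteOfCentres s).eval x with hq
    have hD : σ ^ (s.card + 1) * (derivative (hermiteOfCentres s)).eval x ≤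
        s.card * (2 / R * q) := by
      rw [derivative_hermiteOfCentres, ← coe_evalRingHom, map_multiset_sum, Multiset.map_map,
        ← Multiset.sum_map_mul_left, ← nsmul_eq_mul]
      refine (Multiset.sum_le_card_nsmul _ (2 / R * q) ?_).trans_eq (by simp)
      simp only [Multiset.mem_map, Function.comp_apply, coe_evalRingHom, forall_exists_index,
        and_imp, forall_apply_eq_imp_iff₂]
      intro c hc
      have h2 := (step c hc).2
      rw [← herase c hc, pow_succ, pow_succ, mul_assoc (σ ^ _) σ σ, hσ, mul_one]
      rw [div_mul_eq_mul_div, le_div_iff₀ hR]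
      linarith
    have hsum : (s.card : ℝ) * (2 / R * q) ≤ R * q := by
      rw [div_mul_eq_mul_div, mul_div_assoc', div_le_iff₀ hR]
      nlinarith
    rw [hermiteOfCentres_cons]
    have e : σ ^ (s.card + 1) * ((X - C b) * hermiteOfCentres s -
          C (2⁻¹ : ℝ) * derivative (hermiteOfCentres s)).eval x =
        σ * (x - b) * q -
          2⁻¹ * (σ ^ (s.card + 1) * (derivative (hermiteOfCentres s)).eval x) := by
      simp only [eval_sub, eval_mul, eval_X, eval_C, hq]
      ring
    rw [e]
    have := mul_le_mul_of_nonneg_right hb hpos.le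
    linarith

lemma hermiteOfCentres_sign {σ R x : ℝ} (hσ : σ * σ = 1) (hR : 0 < R)
    (s : Multiset ℝ) (hs : 2 * (s.card : ℝ) ≤ R ^ 2) (hx : ∀ b ∈ s, R ≤ σ * (x - b)) :
    0 < σ ^ s.card * (hermiteOfCentres s).eval x :=
  (hermiteOfCentres_pos_and_growth hσ hR s hs hx).1

/-! ### Interlacing of zeros -/

lemma exists_zeros_of_alternating {f : ℝ → ℝ} (hf : Continuous f) {M : ℕ} (w : Fin (M + 1) → ℝ)
    (hw : StrictMono w) (hs : ∀ i : Fin (M + 1), 0 < (-1) ^ (M - (i : ℕ)) * f (w i)) :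
    ∃ y : Fin M → ℝ, StrictMono y ∧ ∀ i, f (y i) = 0 ∧ w i.castSucc < y i ∧ y i < w i.succ := by
  have key : ∀ i : Fin M, ∃ t, f t = 0 ∧ w i.castSucc < t ∧ t < w i.succ := by
    intro i
    have hlt : w i.castSucc < w i.succ := hw (Fin.castSucc_lt_succ)
    have h1 := hs i.castSucc
    have h2 := hs i.succ
    obtain ⟨d, hd⟩ : ∃ d, M - (i : ℕ) = d + 1 := ⟨M - i - 1, by omega⟩
    rw [Fin.val_castSucc, hd, pow_succ] at h1
    rw [Fin.val_succ, show M - ((i : ℕ) + 1) = d by omega] at h2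
    rcases neg_one_pow_eq_or ℝ d with h | h <;> rw [h] at h1 h2
    · obtain ⟨t, ht, hft⟩ := intermediate_value_Ioo hlt.le hf.continuousOn
        (show (0 : ℝ) ∈ Set.Ioo (f (w i.castSucc)) (f (w i.succ)) from
          ⟨by linarith, by linarith⟩)
      exact ⟨t, hft, ht.1, ht.2⟩
    · obtain ⟨t, ht, hft⟩ := intermediate_value_Ioo' hlt.le hf.continuousOn
        (show (0 : ℝ) ∈ Set.Ioo (f (w i.succ)) (f (w i.castSucc)) from
          ⟨by linarith, by linarith⟩)
      exact ⟨t, hft, ht.1, ht.2⟩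
  choose y hy using key
  refine ⟨y, fun i j hij => ?_, hy⟩
  calc y i < w i.succ := (hy i).2.2
    _ ≤ w j.castSucc := hw.monotone (by rw [Fin.le_def]; simpa using Nat.succ_le_of_lt hij)
    _ < y j := (hy j).2.1

lemma eq_prod_X_sub_C_of_zeros {N : ℕ} {P : ℝ[X]} (hP : P.Monic) (hN : P.natDegree = N)
    {z : Fin N → ℝ} (hz : Function.Injective z) (h0 : ∀ i, P.eval (z i) = 0) :
    P = ∏ i, (X - C (z i)) := by
  refine eq_of_monic_of_dvd_of_natDegree_le (monic_prod_X_sub_C z _) hP ?_ ?_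
  · refine Finset.prod_dvd_of_coprime (fun i _ j _ hij => ?_) fun i _ => ?_
    · exact pairwise_coprime_X_sub_C hz hij
    · exact dvd_iff_isRoot.mpr (h0 i)
  · rw [natDegree_prod_of_monic _ _ fun i _ => monic_X_sub_C _]
    simp [hN]

lemma prod_erase_sub_sign {N : ℕ} {z : Fin N → ℝ} (hz : StrictMono z) (i : Fin N) :
    0 < (-1) ^ (N - 1 - (i : ℕ)) * ∏ j ∈ Finset.univ.erase i, (z i - z j) := by
  have hsplit : Finset.univ.erase i = Finset.Iio i ∪ Finset.Ioi i := by
    ext j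
    simp only [Finset.mem_erase, Finset.mem_univ, and_true, Finset.mem_union, Finset.mem_Iio,
      Finset.mem_Ioi]
    exact ne_iff_lt_or_gt
  have hdisj : Disjoint (Finset.Iio i) (Finset.Ioi i) := by
    rw [Finset.disjoint_left]
    intro j hj hj'
    exact lt_asymm (Finset.mem_Iio.mp hj) (Finset.mem_Ioi.mp hj')
  rw [hsplit, Finset.prod_union hdisj, ← Fin.card_Ioi, mul_left_comm, ← Finset.prod_const,
    ← Finset.prod_mul_distrib]
  refine mul_pos (Finset.prod_pos fun j hj => ?_) (Finset.prod_pos fun j hj => ?_)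
  · have := hz (Finset.mem_Iio.mp hj)
    linarith
  · have := hz (Finset.mem_Ioi.mp hj)
    linarith

lemma eval_derivative_prod_X_sub_C {N : ℕ} (z : Fin N → ℝ) (i : Fin N) :
    (derivative (∏ j, (X - C (z j)))).eval (z i) = ∏ j ∈ Finset.univ.erase i, (z i - z j) := by
  rw [← Finset.mul_prod_erase _ _ (Finset.mem_univ i), derivative_mul]
  simp [eval_prod]

/-- Adding a centre adds a zero, and the zeros before and after interlace: at a zero `z` of `H_s`
the new polynomial takes the value `-H_s'(z) / 2`, and these values alternate in sign. -/
lemma hermiteOfCentres_cons_interlace (b : ℝ) (s : Multiset ℝ) {N : ℕ} (hN : s.card = N)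
    {z : Fin N → ℝ} (hz : StrictMono z) (hP : hermiteOfCentres s = ∏ i, (X - C (z i))) :
    ∃ y : Fin (N + 1) → ℝ, StrictMono y ∧
      hermiteOfCentres (b ::ₘ s) = ∏ i, (X - C (y i)) ∧ ∀ i, z i < y i.succ := by
  set R : ℝ := 2 * (N + 1) with hRdef
  have hN0 : (0 : ℝ) ≤ N := Nat.cast_nonneg N
  have hR : 0 < R := by positivity
  have hcard : 2 * ((b ::ₘ s).card : ℝ) ≤ R ^ 2 := by
    rw [Multiset.card_cons, hN]
    push_cast
    nlinarith
  obtain ⟨B, hB⟩ := ((b ::ₘ s).toFinset ∪ Finset.univ.image z).bddAbove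
  obtain ⟨A, hA⟩ := ((b ::ₘ s).toFinset ∪ Finset.univ.image z).bddBelow
  simp only [mem_upperBounds, mem_lowerBounds, Finset.mem_coe, Finset.mem_union,
    Multiset.mem_toFinset, Finset.mem_image, Finset.mem_univ, true_and] at hA hB
  have hzB : ∀ i, z i ≤ B := fun i => hB _ (Or.inr ⟨i, rfl⟩)
  have hzA : ∀ i, A ≤ z i := fun i => hA _ (Or.inr ⟨i, rfl⟩)
  have hAB : A ≤ B := (hA b (Or.inl (by simp))).trans (hB b (Or.inl (by simp)))
  have hright := hermiteOfCentres_sign (σ := 1) (x := B + R) (by norm_num) hR (b ::ₘ s) hcard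
    (fun c hc => by have := hB c (Or.inl hc); linarith)
  have hleft := hermiteOfCentres_sign (σ := -1) (x := A - R) (by norm_num) hR (b ::ₘ s) hcard
    (fun c hc => by have := hA c (Or.inl hc); linarith)
  have hmid : ∀ i : Fin N,
      0 < (-1) ^ (N - (i : ℕ)) * (hermiteOfCentres (b ::ₘ s)).eval (z i) := by
    intro i
    have h0 : (hermiteOfCentres s).eval (z i) = 0 := by
      rw [hP, eval_prod]
      exact Finset.prod_eq_zero (Finset.mem_univ i) (by simp)
    have h1 := prod_erase_sub_sign hz i
    rw [← eval_derivative_prod_X_sub_C, ← hP] at h1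
    rw [hermiteOfCentres_cons, show N - (i : ℕ) = N - 1 - i + 1 by omega, pow_succ]
    simp only [eval_sub, eval_mul, eval_X, eval_C, h0]
    linarith
  rw [Multiset.card_cons, hN] at hleft
  let w : Fin (N + 1 + 1) → ℝ := Fin.cons (A - R) (Fin.snoc z (B + R))
  have hw0 : w 0 = A - R := rfl
  have hwlast : w (Fin.last N).succ = B + R := by simp [w]
  have hwmid : ∀ i : Fin N, w i.castSucc.succ = z i := fun i => by simp [w]
  have hw : StrictMono w := by
    rw [Fin.strictMono_iff_lt_succ]
    intro i
    induction i using Fin.cases with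
    | zero =>
      rw [Fin.castSucc_zero, hw0]
      induction (0 : Fin (N + 1)) using Fin.lastCases with
      | last => rw [hwlast]; linarith
      | cast j => rw [hwmid]; have := hzA j; linarith
    | succ i =>
      rw [← Fin.succ_castSucc, hwmid]
      induction h : i.succ using Fin.lastCases with
      | last => rw [hwlast]; have := hzB i; linarith
      | cast j =>
        rw [hwmid]
        refine hz ?_
        rw [Fin.lt_def]
        have := congrArg Fin.val h
        simp at this
        omega
  have hsign : ∀ i : Fin (N + 1 + 1),
      0 < (-1) ^ (N + 1 - (i : ℕ)) * (hermiteOfCentres (b ::ₘ s)).eval (w i) := by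
    intro i
    induction i using Fin.cases with
    | zero => simpa [hw0] using hleft
    | succ i =>
      induction i using Fin.lastCases with
      | last =>
        rw [hwlast]
        simpa using hright
      | cast i => simpa [hwmid] using hmid i
  obtain ⟨y, hy, hyw⟩ := exists_zeros_of_alternating
    (hermiteOfCentres (b ::ₘ s)).continuous w hw hsign
  refine ⟨y, hy, ?_, fun i => ?_⟩
  · obtain ⟨h1, h2⟩ := hermiteOfCentres_monic (b ::ₘ s)
    exact eq_prod_X_sub_C_of_zeros h1 (by rw [h2, Multiset.card_cons, hN]) hy.injective
      fun i => (hyw i).1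
  · have := (hyw i.succ).2.1
    rwa [← Fin.succ_castSucc, hwmid] at this

/-- After `m` further centres, all but the first `m` zeros lie to the right of any lower bound for
the old zeros. -/
lemma exists_zeros_hermiteOfCentres_replicate_add (b : ℝ) (m : ℕ) (s : Multiset ℝ) {N : ℕ}
    (hN : s.card = N) {z : Fin N → ℝ} (hz : StrictMono z)
    (hP : hermiteOfCentres s = ∏ i, (X - C (z i))) {L : ℝ} (hL : ∀ i, L < z i) :
    ∃ y : Fin (N + m) → ℝ, StrictMono y ∧
      hermiteOfCentres (Multiset.replicate m b + s) = ∏ i, (X - C (y i)) ∧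
      ∀ i : Fin (N + m), m ≤ (i : ℕ) → L < y i := by
  induction m with
  | zero => exact ⟨z, hz, by simpa using hP, fun i _ => hL i⟩
  | succ m ih =>
    obtain ⟨y, hy, hyP, hyL⟩ := ih
    obtain ⟨u, hu, huP, huy⟩ := hermiteOfCentres_cons_interlace b _
      (by simp [hN, add_comm]) hy hyP
    refine ⟨u, hu, by rw [Multiset.replicate_succ, Multiset.cons_add]; exact huP,
      fun i hi => ?_⟩
    induction i using Fin.cases with
    | zero => simp at hi
    | succ i => exact (hyL i (by simpa using hi)).trans (huy i)

lemma exists_zeros_hermiteOfCentres (s : Multiset ℝ) :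
    ∃ z : Fin s.card → ℝ, StrictMono z ∧ hermiteOfCentres s = ∏ i, (X - C (z i)) := by
  induction s using Multiset.induction_on with
  | empty =>
    rw [Multiset.card_zero]
    exact ⟨fun _ => 0, fun i => i.elim0, by simp [hermiteOfCentres_zero]⟩
  | cons b s ih =>
    obtain ⟨z, hz, hP⟩ := ih
    obtain ⟨y, hy, hyP, -⟩ := hermiteOfCentres_cons_interlace b s rfl hz hP
    rw [Multiset.card_cons]
    exact ⟨y, hy, hyP⟩

/-! ### Interpolatory quadrature -/

lemma existsUnique_quadrature (c : ℝ) {N m : ℕ} (hm : 0 < m) {z : Fin N → ℝ}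
    (hz : Function.Injective z)
    (ho : ∀ g : ℝ[X], g.natDegree < m →
      gaussianFunctional c (g * ∏ i, (X - C (z i))) = 0) :
    ∃! μ : Fin N → ℝ, ∀ f : ℝ[X], f.natDegree < N + m →
      gaussianFunctional c f = ∑ k, μ k * f.eval (z k) := by
  set P : ℝ[X] := ∏ i, (X - C (z i)) with hPdef
  have hP : P.Monic := monic_prod_X_sub_C z _
  have hPN : P.natDegree = N := by
    rw [hPdef, natDegree_prod_of_monic _ _ fun i _ => monic_X_sub_C _]
    simp
  have hPz : ∀ i, P.eval (z i) = 0 := fun i => by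
    rw [hPdef, eval_prod]
    exact Finset.prod_eq_zero (Finset.mem_univ i) (by simp)
  have hzs : Set.InjOn z (Finset.univ : Finset (Fin N)) := hz.injOn
  have hbasis : ∀ k j, (Lagrange.basis Finset.univ z k).eval (z j) = if j = k then 1 else 0 := by
    intro k j
    split_ifs with h
    · rw [h, Lagrange.eval_basis_self hzs (Finset.mem_univ _)]
    · rw [Lagrange.eval_basis_of_ne (Ne.symm h) (Finset.mem_univ _)]
  refine ⟨fun k => gaussianFunctional c (Lagrange.basis Finset.univ z k), fun f hf => ?_,
    fun μ hμ => funext fun k => ?_⟩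
  · have hr : f %ₘ P =
        ∑ k, C (f.eval (z k)) * Lagrange.basis Finset.univ z k := by
      rw [← Lagrange.interpolate_apply]
      refine Lagrange.eq_interpolate_of_eval_eq _ hzs ?_ fun i _ => ?_
      · rw [Finset.card_univ, Fintype.card_fin, ← hPN, ← degree_eq_natDegree hP.ne_zero]
        exact degree_modByMonic_lt _ hP
      · conv_rhs => rw [← modByMonic_add_div f P]
        simp [hPz]
    conv_lhs => rw [← modByMonic_add_div f P]
    rw [map_add, mul_comm P, ho _ (by rw [natDegree_divByMonic _ hP]; omega), add_zero, hr,
      map_sum]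
    refine Finset.sum_congr rfl fun k _ => ?_
    rw [← smul_eq_C_mul, map_smul, smul_eq_mul, mul_comm]
  · rw [hμ]
    · simp [hbasis]
    · have := Lagrange.degree_basis hzs (Finset.mem_univ k)
      rw [natDegree_eq_of_degree_eq_some this, Finset.card_univ, Fintype.card_fin]
      omega

/-- Gauss-Hermite quadrature, with an upper bound for the nodes. -/
lemma exists_gauss_hermite_quadrature (c : ℝ) {N : ℕ} (hN : 0 < N) {R : ℝ} (hR : 0 < R)
    (hNR : 2 * (N : ℝ) ≤ R ^ 2) :
    ∃ z μ : Fin N → ℝ, Function.Injective z ∧ (∀ i, z i < c / 2 + R) ∧ (∀ i, 0 < μ i) ∧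
      ∀ f : ℝ[X], f.natDegree < N + N →
        gaussianFunctional c f = ∑ k, μ k * f.eval (z k) := by
  obtain ⟨z, hz, hP⟩ : ∃ z : Fin N → ℝ, StrictMono z ∧
      hermiteOfCentres (Multiset.replicate N (c / 2)) = ∏ i, (X - C (z i)) := by
    have h := exists_zeros_hermiteOfCentres (Multiset.replicate N (c / 2))
    rwa [Multiset.card_replicate] at h
  obtain ⟨μ, hμ, -⟩ := existsUnique_quadrature c hN hz.injective (fun g hg => by
    rw [← hP, hermiteOfCentres, Multiset.map_replicate, Multiset.prod_replicate,
      ← mul_one ((X - C (c / 2)) ^ N), gaussianFunctional_mul_hermiteTransform,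
      iterate_derivative_eq_zero hg]
    simp)
  refine ⟨z, μ, hz.injective, fun i => ?_, fun i => ?_, hμ⟩
  · by_contra! h
    have := hermiteOfCentres_sign (σ := 1) (x := z i) (by norm_num) hR
      (Multiset.replicate N (c / 2)) (by simpa using hNR) (fun b hb => by
        rw [Multiset.eq_of_mem_replicate hb]
        linarith)
    rw [hP, eval_prod, Finset.prod_eq_zero (Finset.mem_univ i) (by simp)] at this
    simp at this
  · -- the square of a Lagrange basis polynomial picks out one weight
    have hzs : Set.InjOn z (Finset.univ : Finset (Fin N)) := hz.injective.injOn
    have hdeg : (Lagrange.basis Finset.univ z i).natDegree = N - 1 := by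
      rw [natDegree_eq_of_degree_eq_some (Lagrange.degree_basis hzs (Finset.mem_univ i)),
        Finset.card_univ, Fintype.card_fin]
    have hpos := gaussianFunctional_sq_pos c
      (Lagrange.basis_ne_zero hzs (Finset.mem_univ i))
    rw [hμ _ (by rw [natDegree_pow, hdeg]; omega), Finset.sum_eq_single i] at hpos
    · simpa [Lagrange.eval_basis_self hzs (Finset.mem_univ i)] using hpos
    · intro j _ hj
      simp [Lagrange.eval_basis_of_ne hj.symm (Finset.mem_univ j)]
    · simp

/-- A polynomial of degree less than `2 N` only has to be nonnegative to the left of the bound for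
the Gauss-Hermite nodes, with fewer than `N` zeros there, to have a positive integral. -/
lemma gaussianFunctional_pos_of_nonneg_of_lt (c : ℝ) {N : ℕ} {R : ℝ} (hR : 0 < R)
    (hNR : 2 * (N : ℝ) ≤ R ^ 2) {f : ℝ[X]} (hf : f.natDegree < N + N)
    (hf0 : ∀ t, t < c / 2 + R → 0 ≤ f.eval t) (S : Finset ℝ) (hS : S.card < N)
    (hfS : ∀ t, t < c / 2 + R → f.eval t = 0 → t ∈ S) :
    0 < gaussianFunctional c f := by
  obtain ⟨z, μ, hz, hzR, hμ, hq⟩ := exists_gauss_hermite_quadrature c (by omega) hR hNR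
  obtain ⟨i, hi⟩ : ∃ i, z i ∉ S := by
    by_contra! h
    have := Finset.card_le_card_of_injOn (s := Finset.univ) z (fun i _ => h i) hz.injOn
    simp at this
    omega
  rw [hq f hf]
  refine Finset.sum_pos' (fun k _ => mul_nonneg (hμ k).le (hf0 _ (hzR k)))
    ⟨i, Finset.mem_univ i, mul_pos (hμ i) ((hf0 _ (hzR i)).lt_of_ne' fun h => ?_)⟩
  exact hi (hfS _ (hzR i) h)

/-! ### Signs of the weights of the first quadrature rule -/

lemma prod_sub_sign {ι : Type*} (B : Finset ι) (y : ι → ℝ) {t : ℝ} (ht : ∀ j ∈ B, t < y j) :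
    0 < (-1) ^ B.card * ∏ j ∈ B, (t - y j) := by
  rw [← Finset.prod_const, ← Finset.prod_mul_distrib]
  refine Finset.prod_pos fun j hj => ?_
  have := ht j hj
  linarith

lemma card_filter_val_lt_three_mul (n : ℕ) :
    (Finset.univ.filter fun j : Fin (3 * n) => (j : ℕ) < n).card = n := by
  rw [Fin.card_filter_val_lt]
  omega

lemma card_filter_le_val_three_mul (n : ℕ) :
    (Finset.univ.filter fun j : Fin (3 * n) => n ≤ (j : ℕ)).card = 2 * n := by
  have h := Finset.card_filter_add_card_filter_not (s := (Finset.univ : Finset (Fin (3 * n))))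
    (fun j => (j : ℕ) < n)
  simp only [not_lt] at h
  rw [card_filter_val_lt_three_mul, Finset.card_univ, Fintype.card_fin] at h
  omega

section Signs

variable {c R : ℝ} {n : ℕ} {y lam : Fin (3 * n) → ℝ}

/-- A square vanishing at the zeros of a set `A`, times the linear factors of a set `B` of zeros
to the right of all Gauss-Hermite nodes: the integral has the sign of the second factor. -/
lemma gaussianFunctional_sq_mul_prod_sign (hR : 0 < R)
    (hnR : 4 * (n : ℝ) ≤ R ^ 2) (A B : Finset (Fin (3 * n)))
    (hA : A.card < 2 * n) (hAB : 2 * A.card + B.card < 4 * n) (hB : ∀ j ∈ B, c / 2 + R ≤ y j) :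
    0 < (-1) ^ B.card * gaussianFunctional c
      ((∏ j ∈ A, (X - C (y j))) ^ 2 * ∏ j ∈ B, (X - C (y j))) := by
  have hval : ∀ t, ((-1 : ℝ) ^ B.card • ((∏ j ∈ A, (X - C (y j))) ^ 2 *
      ∏ j ∈ B, (X - C (y j)))).eval t =
        (∏ j ∈ A, (t - y j)) ^ 2 * ((-1) ^ B.card * ∏ j ∈ B, (t - y j)) := by
    intro t
    simp only [eval_smul, eval_mul, eval_pow, eval_prod, eval_sub, eval_X, eval_C, smul_eq_mul]
    ring
  have hBpos : ∀ t, t < c / 2 + R → 0 < (-1) ^ B.card * ∏ j ∈ B, (t - y j) := fun t ht =>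
    prod_sub_sign B y fun j hj => ht.trans_le (hB j hj)
  rw [← smul_eq_mul, ← map_smul]
  refine gaussianFunctional_pos_of_nonneg_of_lt c (N := 2 * n) hR (by push_cast; linarith) ?_
    (fun t ht => ?_) (A.image y) (Finset.card_image_le.trans_lt hA) (fun t ht h0 => ?_)
  · refine (natDegree_smul_le _ _).trans_lt (natDegree_mul_le.trans_lt ?_)
    rw [natDegree_pow, natDegree_prod_of_monic _ _ fun i _ => monic_X_sub_C _,
      natDegree_prod_of_monic _ _ fun i _ => monic_X_sub_C _]
    simp only [natDegree_X_sub_C, Finset.sum_const, smul_eq_mul, mul_one]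
    omega
  · rw [hval]
    exact mul_nonneg (sq_nonneg _) (hBpos t ht).le
  · rw [hval, mul_eq_zero, or_iff_left (hBpos t ht).ne', sq_eq_zero_iff,
      Finset.prod_eq_zero_iff] at h0
    obtain ⟨j, hj, hj0⟩ := h0
    exact Finset.mem_image.mpr ⟨j, hj, by linarith⟩

/-- Exactness on a polynomial vanishing at all nodes but one. -/
lemma weight_mul_eval_of_vanishing (hlam : ∀ f : ℝ[X], f.natDegree < 4 * n →
      gaussianFunctional c f = ∑ k, lam k * f.eval (y k))
    (A B : Finset (Fin (3 * n))) (hAB : 2 * A.card + B.card < 4 * n) {k : Fin (3 * n)}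
    (hk : ∀ j, j ≠ k → j ∈ A ∪ B) :
    gaussianFunctional c ((∏ j ∈ A, (X - C (y j))) ^ 2 * ∏ j ∈ B, (X - C (y j))) =
      lam k * ((∏ j ∈ A, (y k - y j)) ^ 2 * ∏ j ∈ B, (y k - y j)) := by
  rw [hlam, Finset.sum_eq_single k]
  · simp [eval_prod]
  · intro j _ hj
    refine mul_eq_zero_of_right _ ?_
    rw [eval_mul, eval_pow, eval_prod, eval_prod]
    rcases Finset.mem_union.mp (hk j hj) with h | h
    · rw [Finset.prod_eq_zero h (by simp)]
      simp
    · rw [Finset.prod_eq_zero h (by simp), mul_zero]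
  · simp
  · refine natDegree_mul_le.trans_lt ?_
    rw [natDegree_pow, natDegree_prod_of_monic _ _ fun i _ => monic_X_sub_C _,
      natDegree_prod_of_monic _ _ fun i _ => monic_X_sub_C _]
    simp only [natDegree_X_sub_C, Finset.sum_const, smul_eq_mul, mul_one]
    omega

lemma weight_pos_of_lt (hR : 0 < R) (hnR : 4 * (n : ℝ) ≤ R ^ 2)
    (hy : StrictMono y) (hyR : ∀ j : Fin (3 * n), n ≤ (j : ℕ) → c / 2 + R ≤ y j)
    (hlam : ∀ f : ℝ[X], f.natDegree < 4 * n →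
      gaussianFunctional c f = ∑ k, lam k * f.eval (y k))
    (k : Fin (3 * n)) (hk : (k : ℕ) < n) : 0 < lam k := by
  set A := (Finset.univ.filter fun j : Fin (3 * n) => (j : ℕ) < n).erase k with hA
  set B := Finset.univ.filter fun j : Fin (3 * n) => n ≤ (j : ℕ) with hB
  have hAc : A.card = n - 1 := by
    rw [hA, Finset.card_erase_of_mem (by simpa using hk), card_filter_val_lt_three_mul]
  have hBc : B.card = 2 * n := card_filter_le_val_three_mul n
  have h1 := gaussianFunctional_sq_mul_prod_sign (y := y) hR hnR A B (by omega) (by omega)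
    fun j hj => hyR j (by simpa [hB] using hj)
  rw [weight_mul_eval_of_vanishing hlam A B (by omega) (k := k) (fun j hj => by
    simpa [hA, hB, hj] using lt_or_ge _ _), mul_left_comm, mul_left_comm ((-1 : ℝ) ^ _)] at h1
  refine pos_of_mul_pos_left h1 (mul_nonneg (sq_nonneg _) (prod_sub_sign B y fun j hj => ?_).le)
  refine hy (Fin.lt_def.mpr ?_)
  have : n ≤ (j : ℕ) := by simpa [hB] using hj
  omega

lemma weight_sign_of_le (hR : 0 < R) (hnR : 4 * (n : ℝ) ≤ R ^ 2)
    (hy : StrictMono y) (hyR : ∀ j : Fin (3 * n), n ≤ (j : ℕ) → c / 2 + R ≤ y j)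
    (hlam : ∀ f : ℝ[X], f.natDegree < 4 * n →
      gaussianFunctional c f = ∑ k, lam k * f.eval (y k))
    (k : Fin (3 * n)) (hk : n ≤ (k : ℕ)) : 0 < (-1) ^ (3 * n - (k : ℕ)) * lam k := by
  set A := Finset.univ.filter fun j : Fin (3 * n) => (j : ℕ) < n with hA
  set B := (Finset.univ.filter fun j : Fin (3 * n) => n ≤ (j : ℕ)).erase k with hB
  have hkn := k.isLt
  have hAc : A.card = n := card_filter_val_lt_three_mul n
  have hBc : B.card = 2 * n - 1 := by
    rw [hB, Finset.card_erase_of_mem (by simpa using hk), card_filter_le_val_three_mul]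
  have h1 := gaussianFunctional_sq_mul_prod_sign (y := y) hR hnR A B (by omega) (by omega)
    fun j hj => hyR j (by simpa [hB] using (Finset.mem_erase.mp hj).2)
  rw [weight_mul_eval_of_vanishing hlam A B (by omega) (k := k) (fun j hj => by
    simpa [hA, hB, hj] using lt_or_ge _ _), hBc,
    show 2 * n - 1 = 2 * (n - 1) + 1 by omega, pow_succ, pow_mul] at h1
  have hApos : 0 < ∏ j ∈ A, (y k - y j) := Finset.prod_pos fun j hj => by
    have : (j : ℕ) < n := by simpa [hA] using hj
    have := hy (Fin.lt_def.mpr (this.trans_le hk))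
    linarith
  have hAB : (∏ j ∈ A, (y k - y j)) * ∏ j ∈ B, (y k - y j) =
      ∏ j ∈ Finset.univ.erase k, (y k - y j) := by
    rw [← Finset.prod_union]
    · refine Finset.prod_congr ?_ fun _ _ => rfl
      ext j
      simp only [hA, hB, Finset.mem_union, Finset.mem_erase, Finset.mem_filter, Finset.mem_univ,
        true_and, and_true]
      constructor
      · rintro (h | h)
        · rintro rfl
          omega
        · exact h.1
      · intro h
        rcases lt_or_ge (j : ℕ) n with h' | h'
        · exact Or.inl h'
        · exact Or.inr ⟨h, h'⟩
    · rw [Finset.disjoint_left]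
      intro j hj hj'
      simp only [hA, hB, Finset.mem_erase, Finset.mem_filter, Finset.mem_univ, true_and] at hj hj'
      omega
  have h2 := prod_erase_sub_sign hy k
  set D := ∏ j ∈ Finset.univ.erase k, (y k - y j) with hD
  set ε : ℝ := (-1) ^ (3 * n - 1 - (k : ℕ)) with hε
  have hε2 : ε * ε = 1 := by rw [hε, ← mul_pow]; simp
  rw [show 3 * n - (k : ℕ) = 3 * n - 1 - k + 1 by omega, pow_succ, ← hε]
  refine pos_of_mul_pos_left (b := (∏ j ∈ A, (y k - y j)) * (ε * D)) ?_ (mul_pos hApos h2).le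
  calc 0 < _ := h1
    _ = -(lam k * ((∏ j ∈ A, (y k - y j)) * D)) := by rw [← hAB, neg_one_sq, one_pow]; ring
    _ = ε * ε * -(lam k * ((∏ j ∈ A, (y k - y j)) * D)) := by rw [hε2, one_mul]
    _ = _ := by ring

end Signs

/-! ### The diagonal polynomials and the scaling of the nodes -/

lemma isHermiteDiag_iff {chat : ℝ} (hchat : 0 < chat) {n : ℕ} (hn : 1 ≤ n) (H : ℝ[X]) :
    IsHermiteDiag chat n H ↔
      H = hermiteOfCentres (Multiset.replicate n (-(√(n : ℝ) * chat) / 2) +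
        (Multiset.replicate n 0 + Multiset.replicate n (√(n : ℝ) * chat / 2))) := by
  have hc : 0 < √(n : ℝ) * chat := mul_pos (Real.sqrt_pos.mpr (by exact_mod_cast hn)) hchat
  rw [IsHermiteDiag, isMultipleHermite_iff]
  · simp [hermiteOfCentres, Fin.prod_univ_three, mul_assoc]
  · intro i j hij
    fin_cases i <;> fin_cases j <;> simp at hij ⊢ <;> first | linarith | (exfalso; grind)

/-- The zeros of `H_{n,n,n}`. All but the first `n` lie to the right of `-2√n`, since the zeros of
the polynomial with only the centres `0` and `chat √n / 2` do. -/
lemma exists_zeros_of_isHermiteDiag {chat : ℝ} (hchat : 8 < chat) {n : ℕ} (hn : 1 ≤ n) {H : ℝ[X]}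
    (hH : IsHermiteDiag chat n H) :
    ∃ y : Fin (3 * n) → ℝ, StrictMono y ∧ H = ∏ i, (X - C (y i)) ∧
      ∀ i : Fin (3 * n), n ≤ (i : ℕ) → -(2 * √(n : ℝ)) < y i := by
  have hsn : 0 < √(n : ℝ) := Real.sqrt_pos.mpr (by exact_mod_cast hn)
  have hsq : √(n : ℝ) ^ 2 = n := Real.sq_sqrt (Nat.cast_nonneg n)
  set s := Multiset.replicate n (0 : ℝ) + Multiset.replicate n (√(n : ℝ) * chat / 2) with hs
  have hcard : s.card = 2 * n := by
    simp [hs]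
    omega
  obtain ⟨z, hz, hP⟩ := exists_zeros_hermiteOfCentres s
  have hzL : ∀ i, -(2 * √(n : ℝ)) < z i := by
    intro i
    by_contra! h
    have := hermiteOfCentres_sign (σ := -1) (R := 2 * √(n : ℝ)) (x := z i) (by norm_num)
      (by positivity) s (by rw [hcard, mul_pow, hsq]; push_cast; linarith) (fun b hb => by
        have hb0 : 0 ≤ b := by
          rcases Multiset.mem_add.mp hb with hb | hb <;> rw [Multiset.eq_of_mem_replicate hb]
          positivity
        linarith)
    rw [hP, eval_prod, Finset.prod_eq_zero (Finset.mem_univ i) (by simp)] at this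
    simp at this
  have h3 : 3 * n = s.card + n := by omega
  rw [(isHermiteDiag_iff (by linarith) hn H).mp hH, ← hs, h3]
  exact exists_zeros_hermiteOfCentres_replicate_add _ n s rfl hz hP hzL

lemma existsUnique_strictMono_range_eq {N : ℕ} {x : Fin N → ℝ} (hx : StrictMono x) :
    ∃! x' : Fin N → ℝ, StrictMono x' ∧ Set.range x' = Set.range x :=
  ⟨x, ⟨hx, rfl⟩, fun _ h => (StrictMono.range_inj h.1 hx).mp h.2⟩

lemma setOf_eval_sqrt_mul_eq_zero {n : ℕ} (hn : 1 ≤ n) {H : ℝ[X]} {y : Fin (3 * n) → ℝ}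
    (hH : H = ∏ i, (X - C (y i))) :
    {t : ℝ | H.eval (√(n : ℝ) * t) = 0} = Set.range fun i => y i / √(n : ℝ) := by
  have hsn : √(n : ℝ) ≠ 0 := (Real.sqrt_pos.mpr (by exact_mod_cast hn)).ne'
  ext t
  simp only [hH, eval_prod, eval_sub, eval_X, eval_C, Set.mem_ofPred_eq, Finset.prod_eq_zero_iff,
    Finset.mem_univ, true_and, Set.mem_range, sub_eq_zero]
  refine exists_congr fun i => ?_
  rw [div_eq_iff hsn, eq_comm, mul_comm]

lemma integral_eval_sqrt_mul (chat : ℝ) {n : ℕ} (hn : 1 ≤ n) (g : ℝ[X]) :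
    ∫ t : ℝ, g.eval (√(n : ℝ) * t) * Real.exp (-(n : ℝ) * (t ^ 2 + chat * t)) =
      (√(n : ℝ))⁻¹ * gaussianFunctional (-(√(n : ℝ) * chat)) g := by
  have hsq : √(n : ℝ) ^ 2 = n := Real.sq_sqrt (Nat.cast_nonneg n)
  have h := Measure.integral_comp_mul_left
    (fun x : ℝ => g.eval x * Real.exp (-x ^ 2 + -(√(n : ℝ) * chat) * x)) (√(n : ℝ))
  rw [abs_of_nonneg (by positivity), smul_eq_mul] at h
  rw [gaussianFunctional_apply, ← h]
  refine integral_congr_ae (.of_forall fun t => ?_)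
  dsimp only
  congr 2
  rw [mul_pow, hsq]
  linear_combination (chat * t) * hsq

/-- The quadrature rule for the unscaled zeros has the weights `√n * lam k`. -/
lemma isFirstQuadratureWeights_iff (chat : ℝ) {n : ℕ} (hn : 1 ≤ n) (y lam : Fin (3 * n) → ℝ) :
    IsFirstQuadratureWeights chat n (fun i => y i / √(n : ℝ)) lam ↔
      ∀ g : ℝ[X], g.natDegree < 4 * n →
        gaussianFunctional (-(√(n : ℝ) * chat)) g = ∑ k, √(n : ℝ) * lam k * g.eval (y k) := by
  have hsn : √(n : ℝ) ≠ 0 := (Real.sqrt_pos.mpr (by exact_mod_cast hn)).ne'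
  simp only [mul_assoc, ← Finset.mul_sum]
  constructor
  · intro h g hg
    have h1 := h (g.comp (C (√(n : ℝ)) * X)) (by
      rw [natDegree_comp, natDegree_C_mul_X _ hsn]
      omega)
    simp only [eval_comp, eval_mul, eval_C, eval_X, mul_div_cancel₀ _ hsn] at h1
    rw [integral_eval_sqrt_mul chat hn] at h1
    rw [← h1, mul_inv_cancel_left₀ hsn]
  · intro h f hf
    have h1 := h (f.comp (C (√(n : ℝ))⁻¹ * X)) (by
      rw [natDegree_comp, natDegree_C_mul_X _ (inv_ne_zero hsn)]
      omega)
    have h2 := integral_eval_sqrt_mul chat hn (f.comp (C (√(n : ℝ))⁻¹ * X))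
    rw [h1, inv_mul_cancel_left₀ hsn] at h2
    simpa [eval_comp, inv_mul_cancel_left₀ hsn, div_eq_inv_mul] using h2

lemma existsUnique_isFirstQuadratureWeights {chat : ℝ} {n : ℕ} (hn : 1 ≤ n)
    {H : ℝ[X]} (hH : IsHermiteDiag chat n H) {y : Fin (3 * n) → ℝ} (hy : StrictMono y)
    (hP : H = ∏ i, (X - C (y i))) :
    ∃! lam, IsFirstQuadratureWeights chat n (fun i => y i / √(n : ℝ)) lam := by
  have hsn : √(n : ℝ) ≠ 0 := (Real.sqrt_pos.mpr (by exact_mod_cast hn)).ne'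
  obtain ⟨μ, hμ, hμu⟩ := existsUnique_quadrature (-(√(n : ℝ) * chat)) (m := n) (by omega)
    hy.injective (fun g hg => by
      rw [← hP, g.as_sum_range' n hg, Finset.sum_mul, map_sum]
      refine Finset.sum_eq_zero fun k hk => ?_
      have h0 := hH.2.2 0 k (by simpa using hk)
      rw [integral_pow_mul_eval_mul_hermiteWeight] at h0
      rw [← smul_X_eq_monomial, smul_mul_assoc, map_smul]
      exact smul_eq_zero_of_right _ h0)
  rw [show 3 * n + n = 4 * n by ring] at hμ hμu
  refine ⟨fun k => μ k / √(n : ℝ), ?_, fun lam hlam => ?_⟩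
  · simpa only [isFirstQuadratureWeights_iff chat hn, mul_div_cancel₀ _ hsn] using hμ
  · have h := hμu _ ((isFirstQuadratureWeights_iff chat hn y lam).mp hlam)
    funext k
    rw [← h, mul_div_cancel_left₀ _ hsn]

lemma sign_eq_neg_one_zpow {n k : ℕ} (hk : k ≤ 3 * n) {a : ℝ}
    (ha : 0 < (-1) ^ (3 * n - k) * a) :
    Real.sign a = (-1 : ℝ) ^ ((k + 1 : ℤ) - (n : ℤ) + 1) := by
  have he : ((k + 1 : ℤ) - (n : ℤ) + 1) = ((3 * n - k : ℕ) : ℤ) + 2 * (k + 1 - 2 * n) := by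
    push_cast [Nat.cast_sub hk]
    ring
  rw [he, zpow_add₀ (by norm_num), zpow_mul, zpow_natCast]
  norm_num
  rcases neg_one_pow_eq_or ℝ (3 * n - k) with h | h <;> rw [h] at ha ⊢
  · exact Real.sign_of_pos (by linarith)
  · exact Real.sign_of_neg (by linarith)

/- The index `k : Fin (3 * n)` starts from `0`, so it stands for the node number `k + 1`. -/
theorem theorem5p4 (chat : ℝ) (hchat : 8 < chat) (n : ℕ) (hn : 1 ≤ n) :
    (∃! H : ℝ[X], IsHermiteDiag chat n H) ∧
    ∀ H : ℝ[X], IsHermiteDiag chat n H →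
      (∃! x : Fin (3 * n) → ℝ, IsNodes n H x) ∧
      ∀ x : Fin (3 * n) → ℝ, IsNodes n H x →
        (∃! lam : Fin (3 * n) → ℝ, IsFirstQuadratureWeights chat n x lam) ∧
        ∀ lam : Fin (3 * n) → ℝ, IsFirstQuadratureWeights chat n x lam →
          (∀ k : Fin (3 * n), (k : ℕ) + 1 ≤ n → 0 < lam k) ∧
          (∀ k : Fin (3 * n), n + 1 ≤ (k : ℕ) + 1 →
            Real.sign (lam k) = (-1 : ℝ) ^ (((k : ℕ) + 1 : ℤ) - (n : ℤ) + 1)) := by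
  refine ⟨?_, fun H hH => ?_⟩
  · simp only [isHermiteDiag_iff (by linarith : 0 < chat) hn]
    exact existsUnique_eq
  obtain ⟨y, hy, hP, hyL⟩ := exists_zeros_of_isHermiteDiag hchat hn hH
  have hsn : 0 < √(n : ℝ) := Real.sqrt_pos.mpr (by exact_mod_cast hn)
  have hsq : √(n : ℝ) ^ 2 = n := Real.sq_sqrt (Nat.cast_nonneg n)
  have hx0 : StrictMono fun i => y i / √(n : ℝ) := fun i j hij =>
    div_lt_div_of_pos_right (hy hij) hsn
  have hnodes : ∃! x : Fin (3 * n) → ℝ, IsNodes n H x := by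
    simp only [IsNodes, setOf_eval_sqrt_mul_eq_zero hn hP]
    exact existsUnique_strictMono_range_eq hx0
  refine ⟨hnodes, fun x hx => ?_⟩
  obtain rfl : x = fun i => y i / √(n : ℝ) :=
    hnodes.unique hx ⟨hx0, (setOf_eval_sqrt_mul_eq_zero hn hP).symm⟩
  refine ⟨existsUnique_isFirstQuadratureWeights hn hH hy hP, fun lam hlam => ?_⟩
  rw [isFirstQuadratureWeights_iff chat hn] at hlam
  -- the Gauss-Hermite nodes centred at `-chat √n / 2 < -4 √n` are to the left of `-2 √n`
  have hyR : ∀ j : Fin (3 * n), n ≤ (j : ℕ) →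
      -(√(n : ℝ) * chat) / 2 + 2 * √(n : ℝ) ≤ y j := by
    intro j hj
    have h1 := hyL j hj
    have h2 := mul_lt_mul_of_pos_left hchat hsn
    linarith
  have hnR : 4 * (n : ℝ) ≤ (2 * √(n : ℝ)) ^ 2 := by rw [mul_pow, hsq]; norm_num
  refine ⟨fun k hk => ?_, fun k hk => ?_⟩
  · exact pos_of_mul_pos_right
      (weight_pos_of_lt (by positivity) hnR hy hyR hlam k (by omega)) hsn.le
  · refine sign_eq_neg_one_zpow k.isLt.le ?_
    have h := weight_sign_of_le (by positivity) hnR hy hyR hlam k (by omega)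
    rw [mul_left_comm] at h
    exact pos_of_mul_pos_right h hsn.le
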